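/- For an integer $n\ge 0$ let $B_n$ be the $n$-th Bell number, i.e. the number of partitions of a set of $n$ elements. Let $W$ be the principal branch of the Lambert function, i.e. the inverse of the function $[-1,\infty)\ni x\mapsto xe^x$. Put $$E_n=\frac{n!\,\exp(e^{R}-1)}{R^{n}\sqrt{2\pi(n+1)(R+1)}},\quad R=W(n+1),\qquad\qquad E_n^*=\frac{\exp\left(e^{W(n)}+nW(n)-(n+1)\right)}{\sqrt{1+W(n)}}.$$ Then $$\lim_{n\to\infty}\frac{n}{\ln n}\left(\frac{B_n}{E_n}-1\right)=\lim_{n\to\infty}\frac{n}{\ln n}\left(\frac{B_n}{E_n^*}-1\right)=-\frac1{12}.$$ Consequently $\frac{\ln n}{n}$ is the exact order of the relative error of both approximations: there are constants $0<c\le C$ such that, for all sufficiently large $n$, $$c\,\frac{\ln n}{n}\le\left|\frac{B_n}{E_n}-1\right|\le C\,\frac{\ln n}{n}\qquad\text{and}\qquad c\,\frac{\ln n}{n}\le\left|\frac{B_n}{E_n^*}-1\right|\le C\,\frac{\ln n}{n}.$$ -/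

import Mathlib

open Filter Topology Asymptotics

/-- The principal branch of the Lambert `W` function: the inverse of the function
`[-1, ∞) ∋ w ↦ w * exp w` (the values at real numbers below `-1/e`, which are not in the range of
that function, are irrelevant). -/
noncomputable def lambertW : ℝ → ℝ :=
  Function.invFunOn (fun w : ℝ => w * Real.exp w) (Set.Ici (-1))

/-- Sanity check: `w ↦ w * exp w` is strictly increasing on `[-1, ∞)`. -/
theorem strictMonoOn_mul_exp :
    StrictMonoOn (fun w : ℝ => w * Real.exp w) (Set.Ici (-1)) := by
  apply strictMonoOn_of_deriv_pos (convex_Ici _) (by fun_prop)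
  intro x hx
  rw [interior_Ici, Set.mem_Ioi] at hx
  have h : HasDerivAt (fun w : ℝ => w * Real.exp w) (1 * Real.exp x + x * Real.exp x) x :=
    (hasDerivAt_id x).mul (Real.hasDerivAt_exp x)
  rw [h.deriv]
  have := Real.exp_pos x
  nlinarith

/-- Sanity check: `lambertW` is a left inverse of `w ↦ w * exp w` on `[-1, ∞)`. -/
theorem lambertW_mul_exp {w : ℝ} (hw : -1 ≤ w) : lambertW (w * Real.exp w) = w :=
  strictMonoOn_mul_exp.injOn.leftInvOn_invFunOn hw

/-- Sanity check: for `x ≥ 0` the number `lambertW x` is nonnegative and solves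
`w * exp w = x`. -/
theorem lambertW_spec {x : ℝ} (hx : 0 ≤ x) :
    0 ≤ lambertW x ∧ lambertW x * Real.exp (lambertW x) = x := by
  have hc : ContinuousOn (fun w : ℝ => w * Real.exp w) (Set.Icc 0 x) := by fun_prop
  have hmem : x ∈ Set.Icc ((0 : ℝ) * Real.exp 0) (x * Real.exp x) :=
    ⟨by simpa using hx, le_mul_of_one_le_right hx (Real.one_le_exp hx)⟩
  obtain ⟨w, hw, hwx⟩ := intermediate_value_Icc hx hc hmem
  have hwx' : w * Real.exp w = x := hwx
  rw [← hwx', lambertW_mul_exp (by linarith [hw.1])]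
  exact ⟨hw.1, rfl⟩

/-- The asymptotic form `E_n = n! exp(exp R - 1) / (R ^ n * √(2π (n + 1) (R + 1)))` of the Bell
numbers, where `R = W(n + 1)`. -/
noncomputable def bellE (n : ℕ) : ℝ :=
  (n.factorial : ℝ) * Real.exp (Real.exp (lambertW ((n : ℝ) + 1)) - 1) /
    (lambertW ((n : ℝ) + 1) ^ n *
      Real.sqrt (2 * Real.pi * ((n : ℝ) + 1) * (lambertW ((n : ℝ) + 1) + 1)))

/-- The asymptotic form `E_n^* = exp(exp W(n) + n W(n) - (n + 1)) / √(1 + W(n))` of the Bell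
numbers. -/
noncomputable def bellEStar (n : ℕ) : ℝ :=
  Real.exp (Real.exp (lambertW (n : ℝ)) + (n : ℝ) * lambertW (n : ℝ) - ((n : ℝ) + 1)) /
    Real.sqrt (1 + lambertW (n : ℝ))

/-! The generating function `exp (exp z - 1)` turns `B_n` into a Cauchy integral over the circle of
radius `w = W(n)`. There `exp (exp z)` equals `exp (L φ(θ))`, where `L = e^w` and `φ` is the Poisson
characteristic function `poissonChar w`. Because `w e^w = n`, the phase `nθ` is `L w θ`, so the
linear term of the exponent cancels and `θ = 0` is a saddle point.

Put `t = s θ` with `s² = L (w + w²)`. The quadratic part of the exponent is then exactly `-t²/2`.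
The quartic part of `Re φ` and the cubic part of `Im φ` contribute, after multiplication by `L`, the
correction `e^{-t²/2} (t⁴/24 - t⁶/72)` in the limit `w → ∞`. Its Gaussian mean is `3/24 - 15/72 =
-1/12`. Dominated convergence (`saddleIntegrand_bound`, `tendsto_saddleIntegrand_rescaled`) gives
`e^{W(n)} (bellRatio n - 1) → -1/12`.

Since `log n = w + log w`, `e^{W(n)}` is asymptotic to `n / log n`. Finally `B_n / E_n` and `B_n /
E_n^*` differ from `bellRatio n` by factors `1 + O(1/n)`, which are negligible against `log n / n`:
for `E_n^*` the factor is the error of Stirling's formula, for `E_n` the effect of moving the radius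
from `W(n)` to `W(n + 1)`, small because the radius is a stationary point. -/

open MeasureTheory

/-! ### Taylor's formula with a crude remainder -/

/-- If a function vanishes at `0` and its derivative is at most `C |x| ^ n`, then it is at most
`C |x| ^ (n + 1)`. -/
theorem norm_le_mul_abs_pow_succ_of_hasDerivAt {f g : ℝ → ℂ} {C : ℝ} {n : ℕ}
    (hf : ∀ x, HasDerivAt f (g x) x) (h0 : f 0 = 0) (hg : ∀ x, ‖g x‖ ≤ C * |x| ^ n) (x : ℝ) :
    ‖f x‖ ≤ C * |x| ^ (n + 1) := by
  have hC : 0 ≤ C := by simpa using (norm_nonneg _).trans (hg 1)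
  have h := (convex_Icc (-|x|) |x|).norm_image_sub_le_of_norm_hasDerivWithin_le
    (f := f) (f' := g) (C := C * |x| ^ n) (x := 0) (y := x)
    (fun y _ => (hf y).hasDerivWithinAt)
    (fun y hy => (hg y).trans
      (mul_le_mul_of_nonneg_left (pow_le_pow_left₀ (abs_nonneg y) (abs_le.2 hy) n) hC))
    (Set.mem_Icc.2 ⟨by simp, abs_nonneg x⟩) (Set.mem_Icc.2 ⟨neg_abs_le x, le_abs_self x⟩)
  simpa [h0, pow_succ, mul_assoc] using h

/-- Taylor's formula at `0` for a chain of successive derivatives, with a crude remainder. -/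
theorem norm_sub_taylor_le {C : ℝ} (n : ℕ) (f : ℕ → ℝ → ℂ)
    (hf : ∀ k < n, ∀ x, HasDerivAt (f k) (f (k + 1) x) x) (hC : ∀ x, ‖f n x‖ ≤ C) (x : ℝ) :
    ‖f 0 x - ∑ k ∈ Finset.range n, f k 0 * (x : ℂ) ^ k / (k.factorial : ℂ)‖ ≤ C * |x| ^ n := by
  induction n generalizing f x with
  | zero => simpa using hC x
  | succ n ih =>
    refine norm_le_mul_abs_pow_succ_of_hasDerivAt
      (f := fun x => f 0 x - ∑ k ∈ Finset.range (n + 1), f k 0 * (x : ℂ) ^ k / (k.factorial : ℂ))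
      (g := fun x => f 1 x - ∑ k ∈ Finset.range n, f (k + 1) 0 * (x : ℂ) ^ k / (k.factorial : ℂ))
      (fun y => ?_) ?_ (fun y => ih (fun k => f (k + 1)) (fun k hk => hf (k + 1) (by omega)) hC y) x
    · refine (hf 0 (by omega) y).sub ?_
      simp only [Finset.sum_range_succ' _ n, pow_zero]
      refine HasDerivAt.add_const _ (HasDerivAt.fun_sum fun k _ => ?_)
      have h := (((hasDerivAt_id y).ofReal_comp.pow (k + 1)).const_mul
        (f (k + 1) 0)).div_const (((k + 1).factorial : ℂ))
      convert! h using 1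
      rw [Nat.factorial_succ]
      have h1 : ((k : ℂ) + 1) ≠ 0 := by exact_mod_cast Nat.succ_ne_zero k
      have h2 : (k.factorial : ℂ) ≠ 0 := by exact_mod_cast Nat.factorial_ne_zero k
      push_cast
      simp only [id]
      field_simp
    · simp [Finset.sum_range_succ']

/-! ### The Poisson characteristic function and its Taylor bounds -/

/-- The characteristic function of the Poisson distribution with parameter `w`. -/
noncomputable def poissonChar (w θ : ℝ) : ℂ :=
  Complex.exp (w * (Complex.exp (θ * Complex.I) - 1))

theorem poissonChar_zero (w : ℝ) : poissonChar w 0 = 1 := by simp [poissonChar]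

theorem hasDerivAt_cexp_mul_I (θ : ℝ) :
    HasDerivAt (fun θ : ℝ => Complex.exp (θ * Complex.I))
      (Complex.I * Complex.exp (θ * Complex.I)) θ := by
  have h := ((hasDerivAt_id θ).ofReal_comp.mul_const Complex.I).cexp
  convert! h using 1
  simp [mul_comm]

theorem hasDerivAt_poissonChar (w θ : ℝ) :
    HasDerivAt (poissonChar w)
      (Complex.I * (w * Complex.exp (θ * Complex.I)) * poissonChar w θ) θ := by
  have h := (((hasDerivAt_cexp_mul_I θ).sub_const 1).const_mul (w : ℂ)).cexp
  convert! h using 1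
  simp only [poissonChar]
  ring

theorem norm_poissonChar (w θ : ℝ) : ‖poissonChar w θ‖ = Real.exp (-(w * (1 - Real.cos θ))) := by
  rw [poissonChar, Complex.norm_exp, Complex.exp_mul_I]
  congr 1
  simp [← Complex.ofReal_cos, ← Complex.ofReal_sin]
  ring

theorem norm_poissonChar_le_one {w : ℝ} (hw : 0 ≤ w) (θ : ℝ) : ‖poissonChar w θ‖ ≤ 1 := by
  rw [norm_poissonChar, Real.exp_le_one_iff]
  have := mul_nonneg hw (sub_nonneg.2 (Real.cos_le_one θ))
  linarith

/-- The first derivatives of `poissonChar w`, in terms of the Touchard polynomials. -/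
noncomputable def poissonCharDeriv (w : ℝ) (k : ℕ) (θ : ℝ) : ℂ :=
  let x : ℂ := w * Complex.exp (θ * Complex.I)
  match k with
  | 0 => poissonChar w θ
  | 1 => Complex.I * x * poissonChar w θ
  | 2 => -(x + x ^ 2) * poissonChar w θ
  | 3 => -Complex.I * (x + 3 * x ^ 2 + x ^ 3) * poissonChar w θ
  | 4 => (x + 7 * x ^ 2 + 6 * x ^ 3 + x ^ 4) * poissonChar w θ
  | _ => Complex.I * (x + 15 * x ^ 2 + 25 * x ^ 3 + 10 * x ^ 4 + x ^ 5) * poissonChar w θ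

theorem hasDerivAt_poissonCharDeriv (w : ℝ) {k : ℕ} (hk : k < 5) (θ : ℝ) :
    HasDerivAt (poissonCharDeriv w k) (poissonCharDeriv w (k + 1) θ) θ := by
  have hx : HasDerivAt (fun θ : ℝ => (w : ℂ) * Complex.exp (θ * Complex.I))
      (Complex.I * (w * Complex.exp (θ * Complex.I))) θ := by
    convert! (hasDerivAt_cexp_mul_I θ).const_mul (w : ℂ) using 1
    ring
  have hp := hasDerivAt_poissonChar w θ
  have hI : Complex.I ^ 2 = -1 := Complex.I_sq
  interval_cases k
  · exact hp
  · convert! (hx.const_mul Complex.I).mul hp using 1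
    simp only [poissonCharDeriv]
    linear_combination (exp := 1) (-((w : ℂ) * Complex.exp (θ * Complex.I) +
      ((w : ℂ) * Complex.exp (θ * Complex.I)) ^ 2) * poissonChar w θ) * hI
  · convert! (hx.add (hx.pow 2)).neg.mul hp using 1
    simp only [poissonCharDeriv, Pi.add_apply, Pi.neg_apply, Pi.pow_apply]
    ring
  · convert! (((hx.add ((hx.pow 2).const_mul 3)).add (hx.pow 3)).const_mul
      (-Complex.I)).mul hp using 1
    simp only [poissonCharDeriv, Pi.add_apply, Pi.pow_apply]
    set x : ℂ := (w : ℂ) * Complex.exp (θ * Complex.I)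
    push_cast
    linear_combination (exp := 1) ((x + 7 * x ^ 2 + 6 * x ^ 3 + x ^ 4) * poissonChar w θ) * hI
  · convert! (((hx.add ((hx.pow 2).const_mul 7)).add ((hx.pow 3).const_mul 6)).add
      (hx.pow 4)).mul hp using 1
    simp only [poissonCharDeriv, Pi.add_apply, Pi.pow_apply]
    push_cast
    ring

/-- Since `‖x‖ = w ≥ 1`, every power is dominated by the top one, so the constant is the sum of the
Touchard coefficients: the Bell numbers 5, 15, 52. -/
theorem norm_poissonCharDeriv_le {w : ℝ} (hw : 1 ≤ w) (θ : ℝ) :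
    ‖poissonCharDeriv w 3 θ‖ ≤ 5 * w ^ 3 ∧ ‖poissonCharDeriv w 4 θ‖ ≤ 15 * w ^ 4 ∧
      ‖poissonCharDeriv w 5 θ‖ ≤ 52 * w ^ 5 := by
  have hw0 : 0 ≤ w := by linarith
  have hp := norm_poissonChar_le_one hw0 θ
  simp only [poissonCharDeriv]
  set x : ℂ := (w : ℂ) * Complex.exp (θ * Complex.I) with hx
  have hn : ‖x‖ = w := by
    rw [hx, norm_mul, Complex.norm_exp_ofReal_mul_I, Complex.norm_real, Real.norm_of_nonneg hw0,
      mul_one]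
  have hpow : ∀ {a b : ℕ}, a ≤ b → w ^ a ≤ w ^ b := fun h => pow_le_pow_right₀ hw h
  refine ⟨?_, ?_, ?_⟩
  · have : ‖x + 3 * x ^ 2 + x ^ 3‖ ≤ 5 * w ^ 3 := by
      refine (norm_add₃_le).trans ?_
      simp only [norm_mul, norm_pow, hn, Complex.norm_ofNat]
      nlinarith [@hpow 1 3 (by omega), @hpow 2 3 (by omega)]
    rw [norm_mul, norm_mul, norm_neg, Complex.norm_I, one_mul]
    exact (mul_le_of_le_one_right (norm_nonneg _) hp).trans this
  · have : ‖x + 7 * x ^ 2 + 6 * x ^ 3 + x ^ 4‖ ≤ 15 * w ^ 4 := by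
      refine (norm_add_le _ _).trans ?_
      refine (add_le_add_left (norm_add₃_le) _).trans ?_
      simp only [norm_mul, norm_pow, hn, Complex.norm_ofNat]
      nlinarith [@hpow 1 4 (by omega), @hpow 2 4 (by omega), @hpow 3 4 (by omega)]
    rw [norm_mul]
    exact (mul_le_of_le_one_right (norm_nonneg _) hp).trans this
  · have : ‖x + 15 * x ^ 2 + 25 * x ^ 3 + 10 * x ^ 4 + x ^ 5‖ ≤ 52 * w ^ 5 := by
      refine (norm_add_le _ _).trans ?_
      refine (add_le_add_left (norm_add_le _ _) _).trans ?_
      refine (add_le_add_left (add_le_add_left (norm_add₃_le) _) _).trans ?_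
      simp only [norm_mul, norm_pow, hn, Complex.norm_ofNat]
      nlinarith [@hpow 1 5 (by omega), @hpow 2 5 (by omega), @hpow 3 5 (by omega),
        @hpow 4 5 (by omega)]
    rw [norm_mul, norm_mul, Complex.norm_I, one_mul]
    exact (mul_le_of_le_one_right (norm_nonneg _) hp).trans this

/-- This bound and the next serve the integrable majorant; the two after them, one order finer,
identify the pointwise limit. -/
theorem poissonChar_im_sub_le {w : ℝ} (hw : 1 ≤ w) (θ : ℝ) :
    |(poissonChar w θ).im - w * θ| ≤ 5 * w ^ 3 * |θ| ^ 3 := by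
  have h := (Complex.abs_im_le_norm _).trans (norm_sub_taylor_le 3 (poissonCharDeriv w)
    (fun k hk x => hasDerivAt_poissonCharDeriv w (by omega) x)
    (fun x => (norm_poissonCharDeriv_le hw x).1) θ)
  refine (congrArg abs ?_).trans_le h
  simp [Finset.sum_range_succ, poissonCharDeriv, poissonChar_zero, Nat.factorial,
    ← Complex.ofReal_pow]

theorem poissonChar_re_sub_le {w : ℝ} (hw : 1 ≤ w) (θ : ℝ) :
    |(poissonChar w θ).re - 1 + (w + w ^ 2) * θ ^ 2 / 2| ≤ 15 * w ^ 4 * θ ^ 4 := by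
  have h := (Complex.abs_re_le_norm _).trans (norm_sub_taylor_le 4 (poissonCharDeriv w)
    (fun k hk x => hasDerivAt_poissonCharDeriv w (by omega) x)
    (fun x => (norm_poissonCharDeriv_le hw x).2.1) θ)
  rw [(show Even 4 by decide).pow_abs] at h
  refine (congrArg abs ?_).trans_le h
  simp [Finset.sum_range_succ, poissonCharDeriv, poissonChar_zero, Nat.factorial,
    ← Complex.ofReal_pow]
  ring

theorem poissonChar_im_sub_cubic_le {w : ℝ} (hw : 1 ≤ w) (θ : ℝ) :
    |(poissonChar w θ).im - w * θ + (w + 3 * w ^ 2 + w ^ 3) * θ ^ 3 / 6| ≤ 15 * w ^ 4 * θ ^ 4 := by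
  have h := (Complex.abs_im_le_norm _).trans (norm_sub_taylor_le 4 (poissonCharDeriv w)
    (fun k hk x => hasDerivAt_poissonCharDeriv w (by omega) x)
    (fun x => (norm_poissonCharDeriv_le hw x).2.1) θ)
  rw [(show Even 4 by decide).pow_abs] at h
  refine (congrArg abs ?_).trans_le h
  simp [Finset.sum_range_succ, poissonCharDeriv, poissonChar_zero, Nat.factorial,
    ← Complex.ofReal_pow]
  ring

theorem poissonChar_re_sub_quartic_le {w : ℝ} (hw : 1 ≤ w) (θ : ℝ) :
    |(poissonChar w θ).re - 1 + (w + w ^ 2) * θ ^ 2 / 2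
      - (w + 7 * w ^ 2 + 6 * w ^ 3 + w ^ 4) * θ ^ 4 / 24| ≤ 52 * w ^ 5 * |θ| ^ 5 := by
  have h := (Complex.abs_re_le_norm _).trans (norm_sub_taylor_le 5 (poissonCharDeriv w)
    (fun k hk x => hasDerivAt_poissonCharDeriv w (by omega) x)
    (fun x => (norm_poissonCharDeriv_le hw x).2.2) θ)
  refine (congrArg abs ?_).trans_le h
  simp [Finset.sum_range_succ, poissonCharDeriv, poissonChar_zero, Nat.factorial,
    ← Complex.ofReal_pow]
  ring

/-! ### Gaussian integrals -/

theorem integrable_pow_mul_exp_neg_sq_div_two (k : ℕ) :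
    Integrable fun t : ℝ => t ^ k * Real.exp (-t ^ 2 / 2) := by
  have h := integrable_rpow_mul_exp_neg_mul_sq (b := 1 / 2) (by norm_num) (s := k)
    (by linarith [k.cast_nonneg (α := ℝ)])
  refine h.congr (ae_of_all _ fun t => ?_)
  simp only [Real.rpow_natCast]
  congr 2
  ring

theorem integral_exp_neg_sq_div_two :
    ∫ t : ℝ, Real.exp (-t ^ 2 / 2) = √(2 * Real.pi) := by
  have h := integral_gaussian (1 / 2)
  rw [show Real.pi / (1 / 2) = 2 * Real.pi by ring] at h
  rw [← h]
  congr 1 with t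
  congr 1
  ring

/-- Adding `e^{-t²/2}/12` makes the integrand the derivative of an odd polynomial times `e^{-t²/2}`,
whose integral vanishes. -/
theorem integral_exp_neg_sq_div_two_mul_quartic_sub_sextic :
    ∫ t : ℝ, Real.exp (-t ^ 2 / 2) * (t ^ 4 / 24 - t ^ 6 / 72) = -(1 / 12) * √(2 * Real.pi) := by
  have hi := integrable_pow_mul_exp_neg_sq_div_two
  have hi0 : Integrable fun t : ℝ => Real.exp (-t ^ 2 / 2) := by simpa using hi 0
  have hT : Integrable fun t : ℝ => Real.exp (-t ^ 2 / 2) * (t ^ 4 / 24 - t ^ 6 / 72) := by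
    refine (((hi 4).const_mul (1 / 24)).sub ((hi 6).const_mul (1 / 72))).congr
      (ae_of_all _ fun t => ?_)
    simp only [Pi.sub_apply]
    ring
  have hz := integral_eq_zero_of_hasDerivAt_of_integrable
    (f := fun t : ℝ => (t ^ 5 / 72 + t ^ 3 / 36 + t / 12) * Real.exp (-t ^ 2 / 2))
    (f' := fun t : ℝ => Real.exp (-t ^ 2 / 2) * (t ^ 4 / 24 - t ^ 6 / 72) +
      (1 / 12) * Real.exp (-t ^ 2 / 2)) (fun t => ?_) (hT.add (hi0.const_mul _)) ?_
  · rw [integral_add hT (hi0.const_mul _), integral_const_mul, integral_exp_neg_sq_div_two] at hz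
    linarith
  · have h1 : HasDerivAt (fun t : ℝ => t ^ 5 / 72 + t ^ 3 / 36 + t / 12)
        (5 * t ^ 4 / 72 + 3 * t ^ 2 / 36 + 1 / 12) t := by
      convert! (((hasDerivAt_pow 5 t).div_const 72).add ((hasDerivAt_pow 3 t).div_const 36)).add
        ((hasDerivAt_id t).div_const 12) using 1
    have h2 : HasDerivAt (fun t : ℝ => -t ^ 2 / 2) (-t) t := by
      convert! (hasDerivAt_pow 2 t).neg.div_const 2 using 1
      push_cast
      ring
    convert! h1.mul h2.exp using 1
    ring
  · refine ((((hi 5).const_mul (1 / 72)).add ((hi 3).const_mul (1 / 36))).add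
      ((hi 1).const_mul (1 / 12))).congr (ae_of_all _ fun t => ?_)
    simp only [Pi.add_apply]
    ring

/-! ### Uniform bounds for the saddle point integrand -/

/-- The real part of the integrand of the Cauchy integral for Bell numbers on the circle of
radius `w`, normalised to be `1` at `θ = 0`. -/
noncomputable def saddleIntegrand (w θ : ℝ) : ℝ :=
  Real.exp (Real.exp w * ((poissonChar w θ).re - 1)) *
    Real.cos (Real.exp w * ((poissonChar w θ).im - w * θ))

/-- The scale of `saddleIntegrand w` near its maximum. -/
noncomputable def saddleScale (w : ℝ) : ℝ := Real.exp (w / 2) * w * √(1 + 1 / w)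

theorem saddleScale_pos {w : ℝ} (hw : 0 < w) : 0 < saddleScale w := by
  unfold saddleScale
  positivity

theorem saddleScale_sq {w : ℝ} (hw : 0 < w) :
    saddleScale w ^ 2 = Real.exp w * (w + w ^ 2) := by
  rw [saddleScale, mul_pow, mul_pow, Real.sq_sqrt (by positivity), ← Real.exp_nat_mul]
  rw [show ((2 : ℕ) : ℝ) * (w / 2) = w by push_cast; ring]
  field_simp
  ring

theorem exp_mul_sq_le_saddleScale_sq {w : ℝ} (hw : 0 < w) :
    Real.exp w * w ^ 2 ≤ saddleScale w ^ 2 := by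
  rw [saddleScale_sq hw]
  gcongr
  linarith

theorem abs_exp_sub_exp_le {x y z : ℝ} (hx : x ≤ z) (hy : y ≤ z) :
    |Real.exp x - Real.exp y| ≤ Real.exp z * |x - y| := by
  wlog h : y ≤ x generalizing x y
  · rw [abs_sub_comm, abs_sub_comm x]
    exact this hy hx (le_of_not_ge h)
  rw [abs_of_nonneg (sub_nonneg.2 (Real.exp_le_exp.2 h)), abs_of_nonneg (sub_nonneg.2 h)]
  have h1 := Real.add_one_le_exp (y - x)
  have h2 : Real.exp y = Real.exp x * Real.exp (y - x) := by rw [← Real.exp_add]; ring_nf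
  calc Real.exp x - Real.exp y = Real.exp x * (1 - Real.exp (y - x)) := by rw [h2]; ring
    _ ≤ Real.exp x * (x - y) :=
      mul_le_mul_of_nonneg_left (by linarith) (Real.exp_pos x).le
    _ ≤ Real.exp z * (x - y) := by
      have := sub_nonneg.2 h
      gcongr

/-- With exponent `A` and phase `B`, both `A + T/2 = O(T²/L)` and `B² = O(T³/L)`, so the factor `L`
in front is absorbed. -/
theorem saddleIntegrand_sub_le_of_le {w θ : ℝ} (hw : 1 ≤ w) (hθ : w * |θ| ≤ 1 / 8) :
    |Real.exp w * (saddleIntegrand w θ - Real.exp (-(saddleScale w * θ) ^ 2 / 2))| ≤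
      (15 * (saddleScale w * θ) ^ 4 + 25 / 2 * (saddleScale w * θ) ^ 6) *
        Real.exp (-(saddleScale w * θ) ^ 2 / 4) := by
  have hw0 : 0 < w := by linarith
  set L := Real.exp w with hL
  have hL0 : 0 < L := Real.exp_pos w
  set T := (saddleScale w * θ) ^ 2 with hT
  have hTe : T = L * ((w + w ^ 2) * θ ^ 2) := by
    rw [hT, mul_pow, saddleScale_sq hw0]; ring
  have hx : w ^ 2 * θ ^ 2 ≤ 1 / 64 := by
    have : (w * |θ|) ^ 2 ≤ (1 / 8) ^ 2 := by gcongr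
    rw [mul_pow, sq_abs] at this
    linarith
  set X := L * (w ^ 2 * θ ^ 2) with hX
  have hX0 : 0 ≤ X := by positivity
  have hXT : X ≤ T := by
    rw [hTe, hX]
    gcongr
    linarith
  set A := L * ((poissonChar w θ).re - 1) with hA
  set B := L * ((poissonChar w θ).im - w * θ) with hB
  have hA1 : |A + T / 2| ≤ 15 * L * (w ^ 2 * θ ^ 2) ^ 2 := by
    rw [show A + T / 2 = L * ((poissonChar w θ).re - 1 + (w + w ^ 2) * θ ^ 2 / 2) by
      rw [hA, hTe]; ring, abs_mul, abs_of_pos hL0]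
    calc _ ≤ L * (15 * w ^ 4 * θ ^ 4) := by gcongr; exact poissonChar_re_sub_le hw θ
      _ = _ := by ring
  -- The threshold 1/8 gives `15/64 ≤ 1/4`, which leaves half of the Gaussian decay.
  have hA2 : |A + T / 2| ≤ T / 4 := by
    refine hA1.trans ?_
    calc 15 * L * (w ^ 2 * θ ^ 2) ^ 2 = 15 * X * (w ^ 2 * θ ^ 2) := by rw [hX]; ring
      _ ≤ 15 * X * (1 / 64) := by gcongr
      _ ≤ T / 4 := by linarith
  have hA3 : L * |A + T / 2| ≤ 15 * T ^ 2 := by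
    calc L * |A + T / 2| ≤ L * (15 * L * (w ^ 2 * θ ^ 2) ^ 2) := by gcongr
      _ = 15 * X ^ 2 := by rw [hX]; ring
      _ ≤ 15 * T ^ 2 := by gcongr
  have hB1 : L * B ^ 2 ≤ 25 * T ^ 3 := by
    have h1 : |B| ≤ L * (5 * w ^ 3 * |θ| ^ 3) := by
      rw [hB, abs_mul, abs_of_pos hL0]
      gcongr
      exact poissonChar_im_sub_le hw θ
    calc L * B ^ 2 = L * |B| ^ 2 := by rw [sq_abs]
      _ ≤ L * (L * (5 * w ^ 3 * |θ| ^ 3)) ^ 2 := by gcongr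
      _ = 25 * (L * (w ^ 2 * |θ| ^ 2)) ^ 3 := by ring
      _ = 25 * X ^ 3 := by rw [sq_abs]
      _ ≤ 25 * T ^ 3 := by gcongr
  have hAT : A ≤ -T / 4 := by linarith [(abs_le.1 hA2).2]
  have hT0 : 0 ≤ T := hX0.trans hXT
  have hc : |Real.cos B - 1| ≤ B ^ 2 / 2 := by
    rw [abs_sub_comm, abs_of_nonneg (sub_nonneg.2 (Real.cos_le_one B))]
    linarith [Real.one_sub_sq_div_two_le_cos (x := B)]
  have he : |Real.exp A - Real.exp (-T / 2)| ≤ Real.exp (-T / 4) * |A + T / 2| := by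
    have := abs_exp_sub_exp_le hAT (show -T / 2 ≤ -T / 4 by linarith)
    rwa [show A - -T / 2 = A + T / 2 by ring] at this
  rw [abs_mul, abs_of_pos hL0]
  have hs : saddleIntegrand w θ - Real.exp (-T / 2) =
      Real.exp A * (Real.cos B - 1) + (Real.exp A - Real.exp (-T / 2)) := by
    rw [saddleIntegrand]; ring
  have h4 : (saddleScale w * θ) ^ 4 = T ^ 2 := by rw [hT]; ring
  have h6 : (saddleScale w * θ) ^ 6 = T ^ 3 := by rw [hT]; ring
  rw [hs, h4, h6]
  calc L * |Real.exp A * (Real.cos B - 1) + (Real.exp A - Real.exp (-T / 2))|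
      ≤ L * (Real.exp (-T / 4) * (B ^ 2 / 2) + Real.exp (-T / 4) * |A + T / 2|) := by
        gcongr
        refine (abs_add_le _ _).trans (add_le_add ?_ he)
        rw [abs_mul, abs_of_pos (Real.exp_pos A)]
        gcongr
    _ = (L * |A + T / 2| + (L * B ^ 2) / 2) * Real.exp (-T / 4) := by ring
    _ ≤ _ := by gcongr; linarith

theorem abs_saddleIntegrand_le (w θ : ℝ) :
    |saddleIntegrand w θ| ≤ Real.exp (Real.exp w * ((poissonChar w θ).re - 1)) := by
  rw [saddleIntegrand, abs_mul, abs_of_pos (Real.exp_pos _)]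
  exact mul_le_of_le_one_right (Real.exp_pos _).le (Real.abs_cos_le_one _)

/-- Away from the saddle the prefactor `e^w` costs only a power of `t`. -/
theorem exp_le_of_le_mul_abs {w θ : ℝ} (hw : 0 < w) (hθ : 1 / 8 ≤ w * |θ|) :
    Real.exp w ≤ 64 * (saddleScale w * θ) ^ 2 := by
  have h1 : (1 / 8 : ℝ) ^ 2 ≤ (w * |θ|) ^ 2 := by gcongr
  rw [mul_pow, sq_abs] at h1
  rw [mul_pow]
  calc Real.exp w ≤ Real.exp w * (64 * (w ^ 2 * θ ^ 2)) :=
        le_mul_of_one_le_right (Real.exp_pos _).le (by linarith)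
    _ = 64 * (Real.exp w * w ^ 2 * θ ^ 2) := by ring
    _ ≤ _ := by gcongr; exact exp_mul_sq_le_saddleScale_sq hw

/-- Here `‖φ‖` stays below 1 by an amount of order `1/w`, and `e^w/(640 w)` exceeds `8 w e^{w/2} ≥
|t|` once `5120 w² ≤ e^{w/2}`. -/
theorem saddleIntegrand_le_of_ge {w θ : ℝ} (hw : 1 ≤ w) (hw' : 5120 * w ^ 2 ≤ Real.exp (w / 2))
    (hθ : 1 / 8 ≤ w * |θ|) (hπ : |θ| ≤ Real.pi) :
    |saddleIntegrand w θ| ≤ Real.exp (-|saddleScale w * θ|) := by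
  have hw0 : 0 < w := by linarith
  refine (abs_saddleIntegrand_le w θ).trans (Real.exp_le_exp.2 ?_)
  have hre := (Complex.re_le_norm (poissonChar w θ)).trans_eq (norm_poissonChar w θ)
  have hcos := Real.cos_le_one_sub_mul_cos_sq hπ
  -- `1 - cos θ ≥ θ²/5` and `w²θ² ≥ 1/64`, with `320 = 5 · 64`.
  have h1 : 1 / (320 * w) ≤ w * (1 - Real.cos θ) := by
    have h2 : (1 / 8 : ℝ) ^ 2 ≤ (w * |θ|) ^ 2 := by gcongr
    rw [mul_pow, sq_abs] at h2
    have h3 : 1 / 5 * θ ^ 2 ≤ 1 - Real.cos θ := by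
      have : (1 : ℝ) / 5 ≤ 2 / Real.pi ^ 2 := by
        rw [div_le_div_iff₀ (by norm_num) (by positivity)]
        nlinarith [Real.pi_lt_d2, Real.pi_pos]
      nlinarith [sq_nonneg θ]
    have h4 : w * (1 / 5 * θ ^ 2) ≤ w * (1 - Real.cos θ) := by gcongr
    refine le_trans ?_ h4
    rw [div_le_iff₀ (by positivity)]
    nlinarith
  set x := 1 / (320 * w) with hx
  have hx0 : 0 < x := by positivity
  have hx1 : x ≤ 1 := by
    rw [hx, div_le_one (by positivity)]
    linarith
  have h5 : Real.exp (-(w * (1 - Real.cos θ))) ≤ 1 - x / 2 := by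
    calc Real.exp (-(w * (1 - Real.cos θ))) ≤ Real.exp (-x) := Real.exp_le_exp.2 (by linarith)
      _ = (Real.exp x)⁻¹ := Real.exp_neg x
      _ ≤ (x + 1)⁻¹ := by gcongr; exact Real.add_one_le_exp x
      _ ≤ 1 - x / 2 := by
        rw [inv_le_iff_one_le_mul₀ (by positivity)]
        nlinarith
  have h6 : Real.exp w * ((poissonChar w θ).re - 1) ≤ Real.exp w * (-(x / 2)) := by
    gcongr
    linarith
  refine h6.trans ?_
  have hm : √(1 + 1 / w) ≤ 2 := by
    rw [Real.sqrt_le_left (by norm_num)]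
    have : 1 / w ≤ 1 := by rw [div_le_one hw0]; exact hw
    linarith
  have h7 : |saddleScale w * θ| ≤ 8 * w * Real.exp (w / 2) := by
    rw [abs_mul, abs_of_pos (saddleScale_pos hw0), saddleScale]
    have : |θ| ≤ 4 := hπ.trans Real.pi_le_four
    calc _ ≤ Real.exp (w / 2) * w * 2 * 4 := by gcongr
      _ = _ := by ring
  have h8 : Real.exp w = Real.exp (w / 2) * Real.exp (w / 2) := by
    rw [← Real.exp_add]; ring_nf
  have h9 : 8 * w * Real.exp (w / 2) ≤ Real.exp w * (x / 2) := by
    have : 8 * w ≤ Real.exp (w / 2) * (x / 2) := by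
      rw [hx, div_div, mul_one_div, le_div_iff₀ (by positivity)]
      linarith
    rw [h8]
    nlinarith [Real.exp_pos (w / 2)]
  linarith

theorem pow_mul_exp_neg_abs_le (k : ℕ) (t : ℝ) :
    |t| ^ k * Real.exp (-|t|) ≤ k.factorial := by
  have h := Real.pow_div_factorial_le_exp |t| (abs_nonneg t) k
  rw [div_le_iff₀ (by positivity)] at h
  rw [Real.exp_neg, ← div_eq_mul_inv, div_le_iff₀ (Real.exp_pos _)]
  linarith

theorem exp_neg_sq_div_four_le (t : ℝ) : Real.exp (-t ^ 2 / 4) ≤ 3 * Real.exp (-|t|) := by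
  have h : -t ^ 2 / 4 ≤ 1 + -|t| := by nlinarith [sq_nonneg (|t| / 2 - 1), sq_abs t]
  calc Real.exp (-t ^ 2 / 4) ≤ Real.exp (1 + -|t|) := Real.exp_le_exp.2 h
    _ = Real.exp 1 * Real.exp (-|t|) := Real.exp_add _ _
    _ ≤ _ := by gcongr; linarith [Real.exp_one_lt_d9]

/-- After multiplication by `1 + t²`, the bounds `|t|^k e^{-|t|} ≤ k!` give `256·2! + 301·4! + 83·6!
+ 38·8! = 1599656`. -/
theorem mul_exp_neg_abs_le (t : ℝ) :
    (256 * t ^ 2 + 45 * t ^ 4 + 38 * t ^ 6) * Real.exp (-|t|) ≤ 1600000 * (1 + t ^ 2)⁻¹ := by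
  rw [← div_eq_mul_inv, le_div_iff₀ (by positivity)]
  have h2 := pow_mul_exp_neg_abs_le 2 t
  have h4 := pow_mul_exp_neg_abs_le 4 t
  have h6 := pow_mul_exp_neg_abs_le 6 t
  have h8 := pow_mul_exp_neg_abs_le 8 t
  rw [Even.pow_abs (by decide)] at h2 h4 h6 h8
  norm_num [Nat.factorial] at h2 h4 h6 h8
  linarith

/-- A common majorant for the rescaled integrands. -/
theorem saddleIntegrand_bound {w : ℝ} (hw : 1 ≤ w) (hw' : 5120 * w ^ 2 ≤ Real.exp (w / 2))
    (θ : ℝ) :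
    |Real.exp w * ((Set.Ioc (-Real.pi) Real.pi).indicator (saddleIntegrand w) θ -
      Real.exp (-(saddleScale w * θ) ^ 2 / 2))| ≤
        1600000 * (1 + (saddleScale w * θ) ^ 2)⁻¹ := by
  have hw0 : 0 < w := by linarith
  set t := saddleScale w * θ with ht
  refine le_trans ?_ (mul_exp_neg_abs_le t)
  have hE := Real.exp_pos (-|t|)
  have h4 := exp_neg_sq_div_four_le t
  -- Near the saddle the integrand is compared with the Gaussian; elsewhere the two are bounded
  -- separately.
  obtain hθ | hθ := le_total (w * |θ|) (1 / 8)
  · have hθ' : |θ| ≤ 1 / 8 := by nlinarith [abs_nonneg θ]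
    have hmem : θ ∈ Set.Ioc (-Real.pi) Real.pi := by
      have := abs_le.1 hθ'
      have := Real.pi_gt_three
      constructor <;> linarith
    rw [Set.indicator_of_mem hmem]
    refine (saddleIntegrand_sub_le_of_le hw hθ).trans ?_
    rw [← ht]
    calc (15 * t ^ 4 + 25 / 2 * t ^ 6) * Real.exp (-t ^ 2 / 4)
        ≤ (15 * t ^ 4 + 25 / 2 * t ^ 6) * (3 * Real.exp (-|t|)) := by gcongr
      _ = (0 * t ^ 2 + 45 * t ^ 4 + 75 / 2 * t ^ 6) * Real.exp (-|t|) := by ring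
      _ ≤ _ := by gcongr <;> norm_num
  · have hL := exp_le_of_le_mul_abs hw0 hθ
    rw [← ht] at hL
    have h2 : Real.exp (-t ^ 2 / 2) ≤ 3 * Real.exp (-|t|) :=
      (Real.exp_le_exp.2 (by linarith [sq_nonneg t])).trans h4
    have hg : |(Set.Ioc (-Real.pi) Real.pi).indicator (saddleIntegrand w) θ| ≤
        Real.exp (-|t|) := by
      by_cases hmem : θ ∈ Set.Ioc (-Real.pi) Real.pi
      · rw [Set.indicator_of_mem hmem]
        exact saddleIntegrand_le_of_ge hw hw' hθ (abs_le.2 ⟨hmem.1.le, hmem.2⟩)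
      · rw [Set.indicator_of_notMem hmem, abs_zero]
        exact hE.le
    rw [abs_mul, abs_of_pos (Real.exp_pos w)]
    calc Real.exp w * |(Set.Ioc (-Real.pi) Real.pi).indicator (saddleIntegrand w) θ -
          Real.exp (-t ^ 2 / 2)|
        ≤ (64 * t ^ 2) * (Real.exp (-|t|) + 3 * Real.exp (-|t|)) := by
          gcongr
          refine (abs_sub _ _).trans (add_le_add hg ?_)
          rwa [abs_of_pos (Real.exp_pos _)]
      _ = (256 * t ^ 2 + 0 + 0) * Real.exp (-|t|) := by ring
      _ ≤ _ := by gcongr <;> positivity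

/-! ### Pointwise limit of the rescaled integrand -/

/-- A first order expansion of `exp (α / L) * cos (β / √L)` as `L → ∞`. -/
theorem tendsto_mul_exp_mul_cos_sub_one {ι : Type*} {l : Filter ι} {r α β : ι → ℝ} {a b : ℝ}
    (hr : Tendsto r l atTop) (hα : Tendsto α l (𝓝 a)) (hβ : Tendsto β l (𝓝 b)) :
    Tendsto (fun i => r i ^ 2 * (Real.exp (α i / r i ^ 2) * Real.cos (β i / r i) - 1)) l
      (𝓝 (a - b ^ 2 / 2)) := by
  have hri : Tendsto (fun i => (r i)⁻¹) l (𝓝 0) := tendsto_inv_atTop_zero.comp hr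
  have hu : Tendsto (fun i => α i / r i ^ 2) l (𝓝 0) := by
    simpa [div_eq_mul_inv] using hα.mul (hri.pow 2)
  have hv : Tendsto (fun i => β i / r i) l (𝓝 0) := by
    simpa [div_eq_mul_inv] using hβ.mul hri
  have hr0 : ∀ᶠ i in l, 0 < r i := hr.eventually_gt_atTop 0
  have h1 : Tendsto (fun i => r i ^ 2 * (Real.exp (α i / r i ^ 2) - 1)) l (𝓝 a) := by
    refine hα.congr_dist (squeeze_zero_norm' (a := fun i => α i * (α i / r i ^ 2)) ?_
      (by simpa using hα.mul hu))
    filter_upwards [hr0, hu.eventually (Metric.closedBall_mem_nhds 0 one_pos)] with i hi hui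
    rw [dist_zero_right, Real.norm_eq_abs] at hui
    have h := Real.abs_exp_sub_one_sub_id_le hui
    rw [Real.norm_of_nonneg dist_nonneg, dist_comm, Real.dist_eq]
    have hα' : α i = r i ^ 2 * (α i / r i ^ 2) := by field_simp
    set u := α i / r i ^ 2
    rw [hα', ← mul_sub, abs_mul, abs_of_pos (by positivity), mul_assoc, ← pow_two]
    gcongr
  have h2 : Tendsto (fun i => r i ^ 2 * (Real.cos (β i / r i) - 1)) l (𝓝 (-(b ^ 2 / 2))) := by
    refine ((hβ.pow 2).div_const 2).neg.congr_dist (squeeze_zero_norm'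
      (a := fun i => β i ^ 2 * (β i / r i) ^ 2) ?_ (by simpa using (hβ.pow 2).mul (hv.pow 2)))
    filter_upwards [hr0, hv.eventually (Metric.closedBall_mem_nhds 0 one_pos)] with i hi hvi
    rw [dist_zero_right, Real.norm_eq_abs] at hvi
    have h := Real.cos_bound hvi
    rw [Real.norm_of_nonneg dist_nonneg, dist_comm, Real.dist_eq]
    have hβ' : β i = r i * (β i / r i) := by field_simp
    set v := β i / r i
    rw [hβ', show r i ^ 2 * (Real.cos v - 1) - -((r i * v) ^ 2 / 2) =
      r i ^ 2 * (Real.cos v - (1 - v ^ 2 / 2)) by ring, abs_mul, abs_of_pos (by positivity),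
      mul_pow, mul_assoc]
    gcongr
    refine h.trans ?_
    rw [Even.pow_abs (by decide)]
    nlinarith [pow_nonneg (sq_nonneg v) 2]
  have h3 := (h1.mul (Real.continuous_cos.continuousAt.tendsto.comp hv)).add h2
  simp only [Real.cos_zero, mul_one] at h3
  rw [sub_eq_add_neg]
  refine h3.congr fun i => ?_
  simp only [Function.comp]
  ring

theorem tendsto_sqrt_one_add_one_div : Tendsto (fun w : ℝ => √(1 + 1 / w)) atTop (𝓝 1) := by
  have h := (tendsto_const_nhds (x := (1 : ℝ))).add (tendsto_inv_atTop_zero (𝕜 := ℝ))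
  simpa using h.sqrt

theorem tendsto_exp_half_atTop : Tendsto (fun w : ℝ => Real.exp (w / 2)) atTop atTop :=
  Real.tendsto_exp_atTop.comp (tendsto_id.atTop_div_const two_pos)

theorem exp_half_sq (w : ℝ) : Real.exp (w / 2) ^ 2 = Real.exp w := by
  rw [← Real.exp_nat_mul]
  congr 1
  push_cast
  ring

/-- As `θ` is asymptotically `t / (e^{w/2} w)`, only the top term `w⁴` of the quartic coefficient
survives, and the fifth order remainder is `O(e^{-w/2})`. The imaginary part behaves likewise, one
order lower. -/
theorem tendsto_poissonChar_re_rescaled (t : ℝ) :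
    Tendsto (fun w => Real.exp (w / 2) ^ 4 * ((poissonChar w (t / saddleScale w)).re - 1 +
      (w + w ^ 2) * (t / saddleScale w) ^ 2 / 2)) atTop (𝓝 (t ^ 4 / 24)) := by
  have hm := tendsto_sqrt_one_add_one_div
  have hi : Tendsto (fun w : ℝ => w⁻¹) atTop (𝓝 0) := tendsto_inv_atTop_zero
  have hr : Tendsto (fun w : ℝ => (Real.exp (w / 2))⁻¹) atTop (𝓝 0) :=
    tendsto_inv_atTop_zero.comp tendsto_exp_half_atTop
  have h1 : Tendsto (fun w : ℝ => t ^ 4 / 24 * ((w⁻¹ ^ 3 + 7 * w⁻¹ ^ 2 + 6 * w⁻¹ + 1) *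
      (√(1 + 1 / w))⁻¹ ^ 4)) atTop (𝓝 (t ^ 4 / 24)) := by
    have := ((((hi.pow 3).add ((hi.pow 2).const_mul 7)).add (hi.const_mul 6)).add_const 1).mul
      ((hm.inv₀ one_ne_zero).pow 4)
    simpa using this.const_mul (t ^ 4 / 24)
  refine h1.congr_dist (squeeze_zero_norm' (a := fun w =>
    52 * |t| ^ 5 * ((Real.exp (w / 2))⁻¹ * (√(1 + 1 / w))⁻¹ ^ 5)) ?_
    (by simpa using (hr.mul ((hm.inv₀ one_ne_zero).pow 5)).const_mul (52 * |t| ^ 5)))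
  filter_upwards [eventually_ge_atTop 1] with w hw
  have hw0 : 0 < w := by linarith
  have hm0 : 0 < √(1 + 1 / w) := by positivity
  have h := poissonChar_re_sub_quartic_le hw (t / saddleScale w)
  rw [Real.norm_of_nonneg dist_nonneg, dist_comm, Real.dist_eq]
  rw [abs_div, abs_of_pos (saddleScale_pos hw0)] at h
  have hr0 := Real.exp_pos (w / 2)
  set P := (poissonChar w (t / saddleScale w)).re
  simp only [saddleScale] at h ⊢
  set m := √(1 + 1 / w)
  set r := Real.exp (w / 2)
  calc _ = r ^ 4 * |P - 1 + (w + w ^ 2) * (t / (r * w * m)) ^ 2 / 2 -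
        (w + 7 * w ^ 2 + 6 * w ^ 3 + w ^ 4) * (t / (r * w * m)) ^ 4 / 24| := by
        rw [← abs_of_pos (pow_pos hr0 4), ← abs_mul, abs_of_pos (pow_pos hr0 4)]
        congr 1
        field_simp
    _ ≤ r ^ 4 * (52 * w ^ 5 * (|t| / (r * w * m)) ^ 5) := by gcongr
    _ = _ := by field_simp

theorem tendsto_poissonChar_im_rescaled (t : ℝ) :
    Tendsto (fun w => Real.exp (w / 2) ^ 3 * ((poissonChar w (t / saddleScale w)).im -
      w * (t / saddleScale w))) atTop (𝓝 (-(t ^ 3 / 6))) := by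
  have hm := tendsto_sqrt_one_add_one_div
  have hi : Tendsto (fun w : ℝ => w⁻¹) atTop (𝓝 0) := tendsto_inv_atTop_zero
  have hr : Tendsto (fun w : ℝ => (Real.exp (w / 2))⁻¹) atTop (𝓝 0) :=
    tendsto_inv_atTop_zero.comp tendsto_exp_half_atTop
  have h1 : Tendsto (fun w : ℝ => -(t ^ 3 / 6) * ((w⁻¹ ^ 2 + 3 * w⁻¹ + 1) *
      (√(1 + 1 / w))⁻¹ ^ 3)) atTop (𝓝 (-(t ^ 3 / 6))) := by
    have := (((hi.pow 2).add (hi.const_mul 3)).add_const 1).mul ((hm.inv₀ one_ne_zero).pow 3)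
    simpa using this.const_mul (-(t ^ 3 / 6))
  refine h1.congr_dist (squeeze_zero_norm' (a := fun w =>
    15 * t ^ 4 * ((Real.exp (w / 2))⁻¹ * (√(1 + 1 / w))⁻¹ ^ 4)) ?_
    (by simpa using (hr.mul ((hm.inv₀ one_ne_zero).pow 4)).const_mul (15 * t ^ 4)))
  filter_upwards [eventually_ge_atTop 1] with w hw
  have hw0 : 0 < w := by linarith
  have hm0 : 0 < √(1 + 1 / w) := by positivity
  have h := poissonChar_im_sub_cubic_le hw (t / saddleScale w)
  rw [Real.norm_of_nonneg dist_nonneg, dist_comm, Real.dist_eq]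
  have hr0 := Real.exp_pos (w / 2)
  set P := (poissonChar w (t / saddleScale w)).im
  simp only [saddleScale] at h ⊢
  set m := √(1 + 1 / w)
  set r := Real.exp (w / 2)
  calc _ = r ^ 3 * |P - w * (t / (r * w * m)) +
        (w + 3 * w ^ 2 + w ^ 3) * (t / (r * w * m)) ^ 3 / 6| := by
        rw [← abs_of_pos (pow_pos hr0 3), ← abs_mul, abs_of_pos (pow_pos hr0 3)]
        congr 1
        field_simp
        ring
    _ ≤ r ^ 3 * (15 * w ^ 4 * (t / (r * w * m)) ^ 4) := by gcongr
    _ = _ := by field_simp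

theorem tendsto_saddleScale : Tendsto saddleScale atTop atTop := by
  refine tendsto_atTop_mono' _ ?_ tendsto_exp_half_atTop
  filter_upwards [eventually_ge_atTop 1] with w hw
  rw [saddleScale, mul_assoc]
  refine le_mul_of_one_le_right (Real.exp_pos _).le (one_le_mul_of_one_le_of_one_le hw ?_)
  rw [Real.one_le_sqrt]
  have : 0 ≤ 1 / w := by positivity
  linarith

/-- The factor `e^{-t²/2}` splits off exactly; what remains is `exp (α/r²) cos (β/r) - 1` with `r =
e^{w/2}`, `α → t⁴/24`, `β → -t³/6`. -/
theorem tendsto_saddleIntegrand_rescaled (t : ℝ) :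
    Tendsto (fun w => Real.exp w * ((Set.Ioc (-Real.pi) Real.pi).indicator (saddleIntegrand w)
      (t / saddleScale w) - Real.exp (-t ^ 2 / 2))) atTop
      (𝓝 (Real.exp (-t ^ 2 / 2) * (t ^ 4 / 24 - t ^ 6 / 72))) := by
  have h := (tendsto_mul_exp_mul_cos_sub_one tendsto_exp_half_atTop
    (tendsto_poissonChar_re_rescaled t) (tendsto_poissonChar_im_rescaled t)).const_mul
      (Real.exp (-t ^ 2 / 2))
  rw [show t ^ 4 / 24 - (-(t ^ 3 / 6)) ^ 2 / 2 = t ^ 4 / 24 - t ^ 6 / 72 by ring] at h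
  refine h.congr' ?_
  have hθ : Tendsto (fun w => t / saddleScale w) atTop (𝓝 0) :=
    tendsto_saddleScale.const_div_atTop t
  filter_upwards [eventually_ge_atTop 1, hθ.eventually
    (Ioc_mem_nhds (neg_lt_zero.2 Real.pi_pos) Real.pi_pos)] with w hw hmem
  have hw0 : 0 < w := by linarith
  rw [Set.indicator_of_mem (Set.mem_Ioc.2 hmem), saddleIntegrand]
  have hs := saddleScale_sq hw0
  have hs0 := saddleScale_pos hw0
  have hr := exp_half_sq w
  have hr0 := Real.exp_pos (w / 2)
  set P := poissonChar w (t / saddleScale w)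
  have ht : Real.exp w * ((w + w ^ 2) * (t / saddleScale w) ^ 2 / 2) = t ^ 2 / 2 := by
    rw [div_pow, hs]
    field_simp
  have hA : Real.exp (Real.exp w * (P.re - 1)) = Real.exp (-t ^ 2 / 2) *
      Real.exp (Real.exp (w / 2) ^ 4 * (P.re - 1 + (w + w ^ 2) * (t / saddleScale w) ^ 2 / 2) /
        Real.exp (w / 2) ^ 2) := by
    rw [← Real.exp_add]
    congr 1
    rw [show ∀ x : ℝ, Real.exp (w / 2) ^ 4 * x / Real.exp (w / 2) ^ 2 =
      Real.exp (w / 2) ^ 2 * x by intro x; field_simp, hr]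
    linear_combination (-1) * ht
  have hB : Real.exp w * (P.im - w * (t / saddleScale w)) =
      Real.exp (w / 2) ^ 3 * (P.im - w * (t / saddleScale w)) / Real.exp (w / 2) := by
    rw [← hr]
    field_simp
  rw [hA, hB, hr]
  ring

/-! ### Dominated convergence -/

theorem continuous_saddleIntegrand (w : ℝ) : Continuous (saddleIntegrand w) := by
  have : Continuous (poissonChar w) :=
    continuous_iff_continuousAt.2 fun θ => (hasDerivAt_poissonChar w θ).continuousAt
  have hre := Complex.continuous_re.comp this
  have him := Complex.continuous_im.comp this
  unfold saddleIntegrand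
  simp only [Function.comp_def] at hre him
  fun_prop

/-- The saddle point expansion of the Cauchy integral, to second order. -/
theorem tendsto_integral_saddleIntegrand :
    Tendsto (fun w => Real.exp w * (saddleScale w *
      (∫ θ in (-Real.pi)..Real.pi, saddleIntegrand w θ) / √(2 * Real.pi) - 1)) atTop
      (𝓝 (-(1 / 12))) := by
  have hexp : ∀ᶠ w : ℝ in atTop, 5120 * w ^ 2 ≤ Real.exp (w / 2) := by
    -- The limit is taken in the variable `w/2`, hence `20480 = 4 · 5120`.
    have h := ((Real.tendsto_exp_div_pow_atTop 2).comp
      (tendsto_id.atTop_div_const (two_pos (α := ℝ)))).eventually_ge_atTop 20480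
    filter_upwards [h, eventually_gt_atTop 0] with w hw hw0
    simp only [Function.comp, id] at hw
    rw [le_div_iff₀ (by positivity)] at hw
    linarith
  have hmeas : ∀ w, Measurable fun t => (Set.Ioc (-Real.pi) Real.pi).indicator (saddleIntegrand w)
      (t / saddleScale w) := fun w =>
    ((continuous_saddleIntegrand w).measurable.indicator measurableSet_Ioc).comp
      (measurable_id.div_const _)
  have hlim := tendsto_integral_filter_of_dominated_convergence (μ := volume) (l := atTop)
    (F := fun w t => Real.exp w * ((Set.Ioc (-Real.pi) Real.pi).indicator (saddleIntegrand w)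
      (t / saddleScale w) - Real.exp (-t ^ 2 / 2)))
    (fun t => 1600000 * (1 + t ^ 2)⁻¹)
    (Eventually.of_forall fun w =>
      (((hmeas w).sub (by fun_prop)).const_mul _).aestronglyMeasurable)
    (by
      filter_upwards [hexp, eventually_ge_atTop 1] with w hw' hw
      refine ae_of_all _ fun t => ?_
      have h := saddleIntegrand_bound hw hw' (t / saddleScale w)
      rwa [mul_div_cancel₀ _ (saddleScale_pos (by linarith)).ne'] at h)
    (integrable_inv_one_add_sq.const_mul _)
    (ae_of_all _ tendsto_saddleIntegrand_rescaled)
  rw [integral_exp_neg_sq_div_two_mul_quartic_sub_sextic] at hlim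
  have hpi : √(2 * Real.pi) ≠ 0 := by positivity
  have h := hlim.div_const √(2 * Real.pi)
  rw [mul_div_cancel_right₀ _ hpi] at h
  refine h.congr' ?_
  filter_upwards [eventually_gt_atTop 0] with w hw
  have hs := saddleScale_pos hw
  have hi0 : Integrable fun t : ℝ => Real.exp (-t ^ 2 / 2) := by
    simpa using integrable_pow_mul_exp_neg_sq_div_two 0
  have hi1 : Integrable ((Set.Ioc (-Real.pi) Real.pi).indicator (saddleIntegrand w)) :=
    (integrable_indicator_iff measurableSet_Ioc).2
      ((continuous_saddleIntegrand w).integrableOn_Icc.mono_set Set.Ioc_subset_Icc_self)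
  rw [integral_const_mul, integral_sub (hi1.comp_div hs.ne') hi0, integral_exp_neg_sq_div_two,
    Measure.integral_comp_div, abs_of_pos hs, integral_indicator measurableSet_Ioc,
    intervalIntegral.integral_of_le (by linarith [Real.pi_pos]), smul_eq_mul]
  field_simp

/-! ### Bell numbers as Cauchy integrals -/

/-- Leibniz's rule for the derivative `e^z · e^{e^z}` reproduces the recurrence of the Bell numbers.
-/
theorem iteratedDeriv_exp_exp_zero (n : ℕ) :
    iteratedDeriv n (fun z => Complex.exp (Complex.exp z)) 0 = Complex.exp 1 * Nat.bell n := by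
  induction n using Nat.strong_induction_on with
  | _ n ih =>
    obtain _ | n := n
    · simp
    have hd : deriv (fun z => Complex.exp (Complex.exp z)) =
        Complex.exp * fun z => Complex.exp (Complex.exp z) := by
      ext z
      rw [((Complex.hasDerivAt_exp z).cexp).deriv, Pi.mul_apply, mul_comm]
    rw [iteratedDeriv_succ', hd, iteratedDeriv_mul Complex.contDiff_exp.contDiffAt
      Complex.contDiff_exp.cexp.contDiffAt, Nat.bell_succ, ← Nat.range_succ_eq_Iic]
    push_cast
    rw [Finset.mul_sum]
    refine Finset.sum_congr rfl fun i _ => ?_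
    rw [ih (n - i) (by omega), iteratedDeriv_eq_iterate, Complex.iter_deriv_exp, Complex.exp_zero]
    ring

/-- The Bell numbers as Fourier coefficients of `exp (exp z)` on a circle. -/
theorem integral_exp_mul_poissonChar {w : ℝ} (hw : 0 < w) (n : ℕ) :
    ∫ θ in (-Real.pi)..Real.pi,
        Complex.exp (Real.exp w * poissonChar w θ - n * θ * Complex.I) =
      ((2 * Real.pi * Real.exp 1 * w ^ n * Nat.bell n / n.factorial : ℝ) : ℂ) := by
  set F : ℝ → ℂ := fun θ => Complex.exp (Real.exp w * poissonChar w θ - n * θ * Complex.I) with hF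
  have hper : Function.Periodic F (2 * Real.pi) := by
    intro θ
    have h1 : Complex.exp (((θ + 2 * Real.pi : ℝ) : ℂ) * Complex.I) =
        Complex.exp (θ * Complex.I) := by
      push_cast
      rw [add_mul, Complex.exp_add, Complex.exp_two_pi_mul_I, mul_one]
    simp only [hF, poissonChar, h1, Complex.exp_sub]
    congr 1
    rw [show (n : ℂ) * ((θ + 2 * Real.pi : ℝ) : ℂ) * Complex.I =
      n * θ * Complex.I + n * (2 * Real.pi * Complex.I) by push_cast; ring, Complex.exp_add,
      Complex.exp_nat_mul_two_pi_mul_I, mul_one]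
  have hshift : ∫ θ in (-Real.pi)..Real.pi, F θ = ∫ θ in (0 : ℝ)..2 * Real.pi, F θ := by
    have := hper.intervalIntegral_add_eq (-Real.pi) 0
    rwa [zero_add, show -Real.pi + 2 * Real.pi = Real.pi by ring] at this
  have hc := DifferentiableOn.circleIntegral_one_div_sub_center_pow_smul (c := 0) hw n
    (f := fun z => Complex.exp (Complex.exp z))
    (Complex.differentiable_exp.cexp.differentiableOn)
  rw [iteratedDeriv_exp_exp_zero, circleIntegral] at hc
  have hint : ∀ θ : ℝ, deriv (circleMap 0 w) θ • (1 / (circleMap 0 w θ - 0) ^ (n + 1)) •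
      Complex.exp (Complex.exp (circleMap 0 w θ)) = Complex.I * ((w : ℂ) ^ n)⁻¹ * F θ := by
    intro θ
    have hw' : (w : ℂ) ≠ 0 := by exact_mod_cast hw.ne'
    have he := Complex.exp_ne_zero (θ * Complex.I)
    have h2 : Complex.exp (Real.exp w * poissonChar w θ) =
        Complex.exp (Complex.exp (w * Complex.exp (θ * Complex.I))) := by
      rw [poissonChar, Complex.ofReal_exp, ← Complex.exp_add]
      congr 2
      ring
    simp only [hF, deriv_circleMap, circleMap, smul_eq_mul, sub_zero, zero_add, Complex.exp_sub, h2]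
    rw [mul_assoc (n : ℂ), Complex.exp_nat_mul]
    field_simp
    ring
  simp only [hint] at hc
  rw [intervalIntegral.integral_const_mul, ← hshift] at hc
  have hw' : (w : ℂ) ^ n ≠ 0 := pow_ne_zero _ (by exact_mod_cast hw.ne')
  have hI := Complex.I_ne_zero
  have hn : (n.factorial : ℂ) ≠ 0 := by exact_mod_cast Nat.factorial_ne_zero n
  have h3 : ∫ θ in (-Real.pi)..Real.pi, F θ = (w : ℂ) ^ n * Complex.I⁻¹ *
      (Complex.I * ((w : ℂ) ^ n)⁻¹ * ∫ θ in (-Real.pi)..Real.pi, F θ) := by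
    field_simp
  rw [h3, hc, smul_eq_mul]
  push_cast
  field_simp

theorem tendsto_lambertW_natCast : Tendsto (fun n : ℕ => lambertW n) atTop atTop := by
  refine tendsto_atTop.2 fun M => ?_
  filter_upwards [tendsto_natCast_atTop_atTop.eventually_gt_atTop (|M| * Real.exp |M|)] with n hn
  obtain ⟨h0, h⟩ := lambertW_spec (n.cast_nonneg (α := ℝ))
  by_contra! hlt
  have hle : lambertW n ≤ |M| := hlt.le.trans (le_abs_self M)
  have : lambertW n * Real.exp (lambertW n) ≤ |M| * Real.exp |M| := by gcongr
  linarith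

/-- The Cauchy integral of the `n`-th Bell number, normalised by its leading approximation. -/
noncomputable def bellRatio (n : ℕ) : ℝ :=
  saddleScale (lambertW n) *
    (∫ θ in (-Real.pi)..Real.pi, saddleIntegrand (lambertW n) θ) / √(2 * Real.pi)

theorem tendsto_bellRatio :
    Tendsto (fun n : ℕ => Real.exp (lambertW n) * (bellRatio n - 1)) atTop (𝓝 (-(1 / 12))) :=
  tendsto_integral_saddleIntegrand.comp tendsto_lambertW_natCast

/-- The saddle equation `hn` rewrites the phase `nθ` as `e^w w θ`; the integral is real, so only
real parts matter. -/
theorem exp_mul_integral_saddleIntegrand {w : ℝ} (hw : 0 < w) {n : ℕ}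
    (hn : w * Real.exp w = n) :
    Real.exp (Real.exp w) * ∫ θ in (-Real.pi)..Real.pi, saddleIntegrand w θ =
      2 * Real.pi * Real.exp 1 * w ^ n * Nat.bell n / n.factorial := by
  have hcont : Continuous (poissonChar w) :=
    continuous_iff_continuousAt.2 fun θ => (hasDerivAt_poissonChar w θ).continuousAt
  have hint : IntervalIntegrable (fun θ : ℝ => Complex.exp (Real.exp w * poissonChar w θ -
      n * θ * Complex.I)) volume (-Real.pi) Real.pi :=
    Continuous.intervalIntegrable (by fun_prop) _ _
  have h := congrArg Complex.re (integral_exp_mul_poissonChar hw n)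
  rw [Complex.ofReal_re] at h
  rw [← h, ← Complex.reCLM_apply, ← Complex.reCLM.intervalIntegral_comp_comm hint,
    ← intervalIntegral.integral_const_mul]
  congr 1 with θ
  rw [Complex.reCLM_apply, Complex.exp_re, saddleIntegrand, ← mul_assoc, ← Real.exp_add]
  congr 2
  · rw [Complex.sub_re, Complex.re_ofReal_mul]
    simp
    ring
  · rw [Complex.sub_im, Complex.im_ofReal_mul]
    simp [← hn]
    ring

theorem bell_eq_bellRatio {n : ℕ} (hn : n ≠ 0) :
    (Nat.bell n : ℝ) = bellRatio n * (n.factorial * Real.exp (Real.exp (lambertW n) - 1) /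
      (lambertW n ^ n * √(2 * Real.pi * n * (lambertW n + 1)))) := by
  obtain ⟨h0, h⟩ := lambertW_spec (n.cast_nonneg (α := ℝ))
  rw [bellRatio]
  set w := lambertW n
  have hn' : (0 : ℝ) < n := by exact_mod_cast Nat.pos_of_ne_zero hn
  have hw : 0 < w := h0.lt_of_ne fun hw => by
    rw [← hw, zero_mul] at h
    exact hn'.ne h
  have hs := saddleScale_pos hw
  have hs2 : √(2 * Real.pi * n * (w + 1)) = √(2 * Real.pi) * saddleScale w := by
    rw [mul_assoc (2 * Real.pi), Real.sqrt_mul (by positivity)]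
    congr 1
    rw [Real.sqrt_eq_iff_mul_self_eq (by positivity) hs.le, ← pow_two, saddleScale_sq hw, ← h]
    ring
  have hI := exp_mul_integral_saddleIntegrand hw h
  have hfac : (0 : ℝ) < n.factorial := by positivity
  rw [hs2, Real.exp_sub]
  have hpi := Real.sq_sqrt (show 0 ≤ 2 * Real.pi by positivity)
  have hpi0 : 0 < √(2 * Real.pi) := by positivity
  have hb : (Nat.bell n : ℝ) = Real.exp (Real.exp w) *
      (∫ θ in (-Real.pi)..Real.pi, saddleIntegrand w θ) * n.factorial /
        (√(2 * Real.pi) ^ 2 * Real.exp 1 * w ^ n) := by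
    rw [hI, hpi]
    field_simp
  rw [hb]
  field_simp

/-! ### Comparison with the two approximations -/

/-- The sequence `log (stirlingSeq n) - 1/(12 n)` increases to `log √π`, so the ratio lies between 1
and `e^{1/(12 n)}`. -/
theorem stirlingSeq_div_sqrt_pi_sub_one_le {n : ℕ} (hn : n ≠ 0) :
    |Stirling.stirlingSeq n / √Real.pi - 1| ≤ 1 / n := by
  have hpi : 0 < √Real.pi := by positivity
  have hle := Stirling.sqrt_pi_le_stirlingSeq hn
  obtain ⟨k, rfl⟩ := Nat.exists_eq_succ_of_ne_zero hn
  have hmono : Monotone fun k : ℕ => Real.log (Stirling.stirlingSeq (k + 1)) -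
      1 / (12 * ((k : ℝ) + 1)) := by
    refine monotone_nat_of_le_succ fun m => ?_
    have h := Stirling.log_stirlingSeq_sdiff_le (m + 1)
    have h2 : 1 / (12 * ((m + 1 : ℕ) : ℝ) * (((m + 1 : ℕ) : ℝ) + 1)) =
        1 / (12 * ((m : ℝ) + 1)) - 1 / (12 * (((m + 1 : ℕ) : ℝ) + 1)) := by
      push_cast
      field_simp
      ring
    rw [h2] at h
    linarith
  have hlim : Tendsto (fun k : ℕ => Real.log (Stirling.stirlingSeq (k + 1)) -
      1 / (12 * ((k : ℝ) + 1))) atTop (𝓝 (Real.log √Real.pi)) := by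
    have h1 := ((tendsto_add_atTop_iff_nat 1).2 Stirling.tendsto_stirlingSeq_sqrt_pi).log hpi.ne'
    have h2 : Tendsto (fun k : ℕ => 1 / (12 * ((k : ℝ) + 1))) atTop (𝓝 0) := by
      have := (tendsto_one_div_add_atTop_nhds_zero_nat (𝕜 := ℝ)).const_mul (1 / 12)
      rw [mul_zero] at this
      refine this.congr fun k => ?_
      field_simp
    simpa using h1.sub h2
  have hk := hmono.ge_of_tendsto hlim k
  have hS : 0 < Stirling.stirlingSeq (k + 1) := Stirling.stirlingSeq'_pos k
  have hk0 : (0 : ℝ) < (k : ℝ) + 1 := by positivity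
  have hdiv : Stirling.stirlingSeq (k + 1) / √Real.pi ≤ Real.exp (1 / (12 * ((k : ℝ) + 1))) := by
    rw [← Real.log_le_iff_le_exp (by positivity), Real.log_div hS.ne' hpi.ne']
    linarith
  have h1 : 1 / (12 * ((k : ℝ) + 1)) ≤ 1 := by
    rw [div_le_one (by positivity)]
    linarith [k.cast_nonneg (α := ℝ)]
  have h2 := abs_exp_sub_exp_le (x := 1 / (12 * ((k : ℝ) + 1))) (y := 0) h1 zero_le_one
  rw [Real.exp_zero, sub_zero, abs_of_pos (a := 1 / (12 * ((k : ℝ) + 1))) (by positivity)] at h2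
  have hge : 1 ≤ Stirling.stirlingSeq (k + 1) / √Real.pi := by rwa [one_le_div hpi]
  rw [Nat.succ_eq_add_one, abs_of_nonneg (by linarith)]
  push_cast
  calc Stirling.stirlingSeq (k + 1) / √Real.pi - 1
      ≤ Real.exp 1 * (1 / (12 * ((k : ℝ) + 1))) := by linarith [(abs_le.1 h2).2]
    _ ≤ 12 * (1 / (12 * ((k : ℝ) + 1))) := by gcongr; linarith [Real.exp_one_lt_d9]
    _ = _ := by field_simp

/-- `E_n^*` is the leading term at radius `W(n)` with `n!` replaced by Stirling's formula, where
`n/e = w e^{w-1}`. -/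
theorem bell_div_bellEStar {n : ℕ} (hn : n ≠ 0) :
    (Nat.bell n : ℝ) / bellEStar n = bellRatio n * (Stirling.stirlingSeq n / √Real.pi) := by
  obtain ⟨h0, h⟩ := lambertW_spec (n.cast_nonneg (α := ℝ))
  rw [bell_eq_bellRatio hn, bellEStar, Stirling.stirlingSeq]
  set w := lambertW n
  have hn' : (0 : ℝ) < n := by exact_mod_cast Nat.pos_of_ne_zero hn
  have hw : 0 < w := h0.lt_of_ne fun hw => by
    rw [← hw, zero_mul] at h
    exact hn'.ne h
  have hsq : √(2 * Real.pi * n * (w + 1)) = √Real.pi * √(2 * n) * √(1 + w) := by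
    rw [← Real.sqrt_mul (by positivity), ← Real.sqrt_mul (by positivity)]
    congr 1
    ring
  have hpow : (n / Real.exp 1 : ℝ) ^ n = w ^ n * Real.exp (n * w - n) := by
    rw [show (n : ℝ) * w - n = n * (w - 1) by ring, Real.exp_nat_mul, ← mul_pow, Real.exp_sub,
      mul_div_assoc', h]
  have hexp : Real.exp (Real.exp w + n * w - (n + 1)) =
      Real.exp (Real.exp w - 1) * Real.exp (n * w - n) := by
    rw [← Real.exp_add]
    congr 1
    ring
  rw [hsq, hpow, hexp]
  have : 0 < √Real.pi := by positivity
  have : 0 < √(2 * n : ℝ) := by positivity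
  have : 0 < √(1 + w) := by positivity
  field_simp

/-- The ratio of the leading approximation of the Bell numbers by `bellE`. -/
noncomputable def bellECorrection (n : ℕ) : ℝ :=
  Real.exp (Real.exp (lambertW n) - Real.exp (lambertW (n + 1)) +
      n * Real.log (lambertW (n + 1) / lambertW n)) *
    √(((n : ℝ) + 1) * (lambertW (n + 1) + 1) / (n * (lambertW n + 1)))

theorem bell_div_bellE {n : ℕ} (hn : n ≠ 0) :
    (Nat.bell n : ℝ) / bellE n = bellRatio n * bellECorrection n := by
  obtain ⟨h0, h⟩ := lambertW_spec (n.cast_nonneg (α := ℝ))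
  obtain ⟨h0', h'⟩ := lambertW_spec (x := (n : ℝ) + 1) (by positivity)
  rw [bell_eq_bellRatio hn, bellE, bellECorrection]
  set w := lambertW n
  set R := lambertW ((n : ℝ) + 1)
  have hn' : (0 : ℝ) < n := by exact_mod_cast Nat.pos_of_ne_zero hn
  have hw : 0 < w := h0.lt_of_ne fun hw => by
    rw [← hw, zero_mul] at h
    exact hn'.ne h
  have hR : 0 < R := h0'.lt_of_ne fun hw => by
    rw [← hw, zero_mul] at h'
    linarith
  have h1 : √(((n : ℝ) + 1) * (R + 1) / (n * (w + 1))) =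
      √(2 * Real.pi * (n + 1) * (R + 1)) / √(2 * Real.pi * n * (w + 1)) := by
    rw [← Real.sqrt_div (by positivity)]
    congr 1
    field_simp
  have h2 : Real.exp (Real.exp w - Real.exp R + n * Real.log (R / w)) =
      Real.exp (Real.exp w - 1) / Real.exp (Real.exp R - 1) * (R ^ n / w ^ n) := by
    rw [Real.exp_add, Real.exp_nat_mul, Real.exp_log (by positivity), div_pow, ← Real.exp_sub]
    congr 2
    ring
  rw [h1, h2]
  have : 0 < √(2 * Real.pi * (n + 1) * (R + 1)) := by positivity
  have : 0 < √(2 * Real.pi * n * (w + 1)) := by positivity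
  field_simp

/-- The function `v ↦ n log v - e^v` is stationary at `v = w`, so a shift `δ = R - w ≤ 1/n` changes
the exponent only to second order. -/
theorem bellECorrection_sub_one_le {n : ℕ} (hw : 1 ≤ lambertW n) :
    |bellECorrection n - 1| ≤ 7 / n := by
  obtain ⟨h0, h⟩ := lambertW_spec (n.cast_nonneg (α := ℝ))
  obtain ⟨h0', h'⟩ := lambertW_spec (x := (n : ℝ) + 1) (by positivity)
  rw [bellECorrection]
  set w := lambertW n
  set R := lambertW ((n : ℝ) + 1)
  have hw0 : 0 < w := by linarith
  have hn1 : (1 : ℝ) ≤ n := by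
    rw [← h]
    exact one_le_mul_of_one_le_of_one_le hw (Real.one_le_exp h0)
  have hn0 : (0 : ℝ) < n := by linarith
  have hwR : w ≤ R := by
    by_contra! hlt
    have : R * Real.exp R ≤ w * Real.exp w := by gcongr
    linarith
  obtain ⟨δ, hδ⟩ : ∃ δ, R = w + δ := ⟨R - w, by ring⟩
  have hδ0 : 0 ≤ δ := by linarith
  set L := Real.exp w with hL
  have hL0 : 0 < L := Real.exp_pos w
  have hR : Real.exp R = L * Real.exp δ := by rw [hδ, Real.exp_add]
  -- From `R e^R = w e^w + 1` and `e^δ ≥ 1 + δ`.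
  have h1 : L * (1 + w) * δ ≤ 1 := by
    have h2 : R * (L * (δ + 1)) ≤ R * Real.exp R := by
      rw [hR]
      gcongr
      exact Real.add_one_le_exp δ
    rw [hδ] at h2
    rw [hδ] at h'
    have : 0 ≤ L * δ ^ 2 := by positivity
    nlinarith
  have hnδ : n * δ ≤ 1 := by
    rw [← h]
    nlinarith [mul_nonneg hL0.le hδ0]
  have hδn : δ ≤ 1 / n := by
    rw [le_div_iff₀ hn0]
    linarith
  have hn1' : 1 / (n : ℝ) ≤ 1 := by rwa [div_le_one hn0]
  have hδ1 : δ ≤ 1 := hδn.trans hn1'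
  have hRw0 : 0 < R / w := div_pos (by linarith) hw0
  have hRw : R / w = 1 + δ / w := by
    rw [hδ]
    field_simp
  have hu0 : 0 ≤ δ / w := by positivity
  set x := L - Real.exp R + n * Real.log (R / w) with hx
  have hnu : n * (δ / w) = L * δ := by
    rw [← h]
    field_simp
  have hx0 : x ≤ 0 := by
    have h2 : Real.log (R / w) ≤ δ / w := by
      have := Real.log_le_sub_one_of_pos hRw0
      linarith
    have h3 : n * Real.log (R / w) ≤ n * (δ / w) := by gcongr
    have h4 : L * (δ + 1) ≤ L * Real.exp δ := by
      gcongr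
      exact Real.add_one_le_exp δ
    linarith
  have hx1 : -(1 / n) ≤ x := by
    have h2 : δ / w - (δ / w) ^ 2 ≤ Real.log (R / w) := by
      have h3 := Real.one_sub_inv_le_log_of_pos hRw0
      refine le_trans ?_ h3
      rw [hRw]
      have : (1 + δ / w)⁻¹ ≤ 1 - δ / w + (δ / w) ^ 2 := by
        rw [inv_le_iff_one_le_mul₀ (by positivity)]
        nlinarith [pow_nonneg hu0 3]
      linarith
    have h3 : n * (δ / w - (δ / w) ^ 2) ≤ n * Real.log (R / w) := by gcongr
    have h4 : Real.exp δ ≤ 1 + δ + δ ^ 2 := by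
      have := (abs_le.1 (Real.abs_exp_sub_one_sub_id_le (x := δ) (by rwa [abs_of_nonneg hδ0]))).2
      linarith
    have h5 : L * Real.exp δ ≤ L * (1 + δ + δ ^ 2) := by gcongr
    have h6 : n * (δ / w) ^ 2 = L * δ * (δ / w) := by rw [pow_two, ← mul_assoc, hnu]
    have h7 : L * δ ^ 2 + L * δ * (δ / w) ≤ δ := by
      calc L * δ ^ 2 + L * δ * (δ / w) = L * (1 + w) * δ * (δ / w) := by
            field_simp
            ring
        _ ≤ 1 * (δ / w) := by gcongr
        _ ≤ δ := by rw [one_mul]; exact div_le_self hδ0 hw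
    nlinarith
  set y := √(((n : ℝ) + 1) * (R + 1) / (n * (w + 1))) with hy
  have hy2 : ((n : ℝ) + 1) * (R + 1) / (n * (w + 1)) = (1 + 1 / n) * (1 + δ / (w + 1)) := by
    rw [hδ]
    field_simp
    ring
  have hδw : δ / (w + 1) ≤ 1 / n := (div_le_self hδ0 (by linarith)).trans hδn
  have hδw0 : 0 ≤ δ / (w + 1) := by positivity
  have hn0' : 0 ≤ 1 / (n : ℝ) := by positivity
  have hy1 : 1 ≤ y := by
    rw [hy, Real.one_le_sqrt, hy2]
    nlinarith
  have hy3 : y ≤ 1 + 3 * (1 / n) := by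
    rw [hy, Real.sqrt_le_left (by positivity), hy2]
    nlinarith
  have he := abs_exp_sub_exp_le hx0 le_rfl
  rw [Real.exp_zero, one_mul, sub_zero, abs_of_nonpos hx0] at he
  calc |Real.exp x * y - 1| = |(Real.exp x - 1) * y + (y - 1)| := by ring_nf
    _ ≤ |Real.exp x - 1| * y + (y - 1) := by
      refine (abs_add_le _ _).trans ?_
      rw [abs_mul, abs_of_nonneg (show 0 ≤ y by linarith), abs_of_nonneg (show 0 ≤ y - 1 by linarith)]
    _ ≤ 1 / n * 4 + 3 * (1 / n) := by
      gcongr <;> linarith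
    _ = 7 / n := by ring

/-! ### From `e^{W(n)}` to `n / log n` -/

theorem tendsto_div_log_div_exp_lambertW :
    Tendsto (fun n : ℕ => (n : ℝ) / Real.log n / Real.exp (lambertW n)) atTop (𝓝 1) := by
  have h1 : Tendsto (fun w : ℝ => (1 + Real.log w / w)⁻¹) atTop (𝓝 1) := by
    have := (Real.isLittleO_log_id_atTop.tendsto_div_nhds_zero.const_add 1).inv₀ (by norm_num)
    simpa using this
  refine (h1.comp tendsto_lambertW_natCast).congr' ?_
  filter_upwards [tendsto_lambertW_natCast.eventually_ge_atTop 1] with n hw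
  obtain ⟨-, h⟩ := lambertW_spec (n.cast_nonneg (α := ℝ))
  simp only [Function.comp]
  set w := lambertW n
  have hw0 : 0 < w := by linarith
  have hlog := Real.log_nonneg hw
  rw [← h, Real.log_mul hw0.ne' (Real.exp_pos w).ne', Real.log_exp]
  have : 0 < Real.log w + w := by linarith
  field_simp
  ring

/-- A factor `1 + O(1 / n)` does not affect the relative error of order `log n / n`. -/
theorem tendsto_div_log_mul_bellRatio_mul_sub_one {ρ : ℕ → ℝ} {C : ℝ}
    (hρ : ∀ᶠ n : ℕ in atTop, |ρ n - 1| ≤ C / n) :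
    Tendsto (fun n : ℕ => (n : ℝ) / Real.log n * (bellRatio n * ρ n - 1)) atTop
      (𝓝 (-(1 / 12))) := by
  have hlog : Tendsto (fun n : ℕ => Real.log n) atTop atTop :=
    Real.tendsto_log_atTop.comp tendsto_natCast_atTop_atTop
  have hρ1 : Tendsto ρ atTop (𝓝 1) := by
    rw [← tendsto_sub_nhds_zero_iff]
    exact squeeze_zero_norm' hρ (tendsto_const_div_atTop_nhds_zero_nat C)
  have h2 : Tendsto (fun n : ℕ => (n : ℝ) / Real.log n * (ρ n - 1)) atTop (𝓝 0) := by
    refine squeeze_zero_norm' ?_ (hlog.const_div_atTop C)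
    filter_upwards [hρ, eventually_gt_atTop 0, hlog.eventually_gt_atTop 0] with n hn hn0 hl
    have hn0' : (0 : ℝ) < n := by exact_mod_cast hn0
    rw [norm_mul, Real.norm_of_nonneg (by positivity), Real.norm_eq_abs]
    calc (n : ℝ) / Real.log n * |ρ n - 1| ≤ n / Real.log n * (C / n) := by gcongr
      _ = C / Real.log n := by field_simp
  have h := ((tendsto_div_log_div_exp_lambertW.mul tendsto_bellRatio).mul hρ1).add h2
  simp only [one_mul, mul_one, add_zero] at h
  refine h.congr fun n => ?_
  have := Real.exp_pos (lambertW n)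
  field_simp
  ring

theorem isTheta_log_div_of_tendsto {f : ℕ → ℝ} {c : ℝ} (hc : c ≠ 0)
    (h : Tendsto (fun n : ℕ => (n : ℝ) / Real.log n * f n) atTop (𝓝 c)) :
    f =Θ[atTop] fun n : ℕ => Real.log n / n := by
  refine (isTheta_of_div_tendsto_nhds_ne_zero (h.congr fun n => ?_) hc).symm
  rw [div_eq_mul_inv (f n), inv_div, mul_comm]

theorem corollary4p5 :
    Tendsto (fun n : ℕ => (n : ℝ) / Real.log (n : ℝ) * ((Nat.bell n : ℝ) / bellE n - 1))
      atTop (𝓝 (-(1 / 12 : ℝ))) ∧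
    Tendsto (fun n : ℕ => (n : ℝ) / Real.log (n : ℝ) * ((Nat.bell n : ℝ) / bellEStar n - 1))
      atTop (𝓝 (-(1 / 12 : ℝ))) ∧
    (fun n : ℕ => (Nat.bell n : ℝ) / bellE n - 1) =Θ[atTop]
      (fun n : ℕ => Real.log (n : ℝ) / (n : ℝ)) ∧
    (fun n : ℕ => (Nat.bell n : ℝ) / bellEStar n - 1) =Θ[atTop]
      (fun n : ℕ => Real.log (n : ℝ) / (n : ℝ)) := by
  have hE : Tendsto (fun n : ℕ => (n : ℝ) / Real.log (n : ℝ) * ((Nat.bell n : ℝ) / bellE n - 1))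
      atTop (𝓝 (-(1 / 12 : ℝ))) := by
    refine (tendsto_div_log_mul_bellRatio_mul_sub_one (ρ := bellECorrection) (C := 7) ?_).congr' ?_
    · filter_upwards [tendsto_lambertW_natCast.eventually_ge_atTop 1] with n hn
      exact bellECorrection_sub_one_le hn
    · filter_upwards [eventually_ne_atTop 0] with n hn
      rw [bell_div_bellE hn]
  have hEStar : Tendsto (fun n : ℕ => (n : ℝ) / Real.log (n : ℝ) *
      ((Nat.bell n : ℝ) / bellEStar n - 1)) atTop (𝓝 (-(1 / 12 : ℝ))) := by
    refine (tendsto_div_log_mul_bellRatio_mul_sub_one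
      (ρ := fun n => Stirling.stirlingSeq n / √Real.pi) (C := 1) ?_).congr' ?_
    · filter_upwards [eventually_ne_atTop 0] with n hn
      exact stirlingSeq_div_sqrt_pi_sub_one_le hn
    · filter_upwards [eventually_ne_atTop 0] with n hn
      rw [bell_div_bellEStar hn]
  exact ⟨hE, hEStar, isTheta_log_div_of_tendsto (by norm_num) hE,
    isTheta_log_div_of_tendsto (by norm_num) hEStar⟩
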